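/- Let $\Bbbk$ be a field of characteristic other than $2$; all points and lines are in the affine plane $\Bbbk^2$, and every line has a canonical equation $tX-uY+v=0$, with $u=1$, or with $u=0$ and $t=1$. A *quadrilateral* $Q=ABA'B'$ consists of four distinct lines $A,B,A',B'$, not all through one point, such that adjacent sides ($A,B$; $B,A'$; $A',B'$; $B',A$) are not parallel; its pairs of opposite sides are $\{A,A'\}$ and $\{B,B'\}$, and its centroid is the midpoint of the midpoints of its diagonals, the diagonals joining $A\cap B$ with $A'\cap B'$ and $B\cap A'$ with $B'\cap A$. A line $\ell$ *crosses* a pair of (possibly equal) lines $\{a,b\}$ if $\ell\ne a$, $\ell\neq b$ and $a,b$ are not both parallel to $\ell$; the midpoint of $\ell$ for this pair is then the midpoint of $\ell\cap a$ and $\ell\cap b$, or the point at infinity of $\ell$ if $\ell$ is parallel to $a$ or to $b$. The line $\ell$ *bisects* a collection of pairs of lines if it has the same midpoint for all the pairs of the collection that it crosses; this common point is the midpoint of $\ell$. A *bisector* of $Q$ is a line that bisects the collection of the two pairs of opposite sides of $Q$, taken together with its midpoint. A collection $\mathbb B$ of pairs of lines is a *bisector arrangement* if each line in each of its pairs bisects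 $\mathbb B$; it is *trivial* if all its lines share a point (possibly at infinity) or every pair is a translate of every other pair. A *bisector field* is a nontrivial bisector arrangement that is not contained in a larger bisector arrangement. Let $$\alpha=t_Au_Bu_{A'}u_{B'}-u_At_Bu_{A'}u_{B'}+u_Au_Bt_{A'}u_{B'}-u_Au_Bu_{A'}t_{B'},\qquad \beta=t_Au_Bt_{A'}u_{B'}-u_At_Bu_{A'}t_{B'},$$ $$\gamma=t_At_Bt_{A'}u_{B'}-t_At_Bu_{A'}t_{B'}+t_Au_Bt_{A'}t_{B'}-u_At_Bt_{A'}t_{B'}.$$ A pair of (possibly equal) bisectors $\ell,\ell'$ of $Q$ is a *$Q$-pair* if the midpoint of their midpoints is the centroid of $Q$ and $\gamma u_\ell u_{\ell'}-\beta(u_\ell t_{\ell'}+t_\ell u_{\ell'})+\alpha t_\ell t_{\ell'}=0$. The *bisector field of $Q$* is the collection of all $Q$-pairs. **Corollary.** (1) Two quadrilaterals have the same bisectors (the same lines with the same midpoints) if and only if they have the same bisector fields. (2) The only pairing that makes the bisectors of a quadrilateral $Q$ a bisector field is $Q$-pairing. That is, for a collection $\mathbb B$ of pairs of lines, the following are equivalent: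 (a) $\mathbb B$ is a bisector field, its lines are exactly the bisectors of $Q$, and whenever a bisector of $Q$ crosses a pair in $\mathbb B$, its midpoint for that pair is its midpoint as a bisector of $Q$; (b) $\mathbb B$ is the bisector field of $Q$. -/

import Mathlib

/-- A line in the plane `k × k`, given by its canonical equation `t X - u Y + v = 0`, where `u = 1`,
or else `u = 0` and `t = 1`. Every line has exactly one such equation. -/
@[ext]
structure Line (k : Type*) [Field k] where
  t : k
  u : k
  v : k
  canonical : u = 1 ∨ (u = 0 ∧ t = 1)

namespace Line

variable {k : Type*} [Field k]

/-- The point `p` lies on the line `l`. -/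
def Contains (l : Line k) (p : k × k) : Prop :=
  l.t * p.1 - l.u * p.2 + l.v = 0

/-- Two lines are parallel (a line is parallel to itself). -/
def Parallel (l m : Line k) : Prop :=
  l.t = m.t ∧ l.u = m.u

/-- The point of intersection of two lines that are not parallel. -/
def meet (l m : Line k) : k × k :=
  ((l.v * m.u - l.u * m.v) / (l.u * m.t - l.t * m.u),
   (l.v * m.t - l.t * m.v) / (l.u * m.t - l.t * m.u))

theorem det_ne_zero {l m : Line k} (h : ¬ l.Parallel m) : l.u * m.t - l.t * m.u ≠ 0 := by
  intro h0
  apply h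
  rcases l.canonical with h1 | ⟨h1, h1'⟩ <;> rcases m.canonical with h3 | ⟨h3, h3'⟩
  · rw [h1, h3] at h0
    exact ⟨by linear_combination -h0, by rw [h1, h3]⟩
  · rw [h1, h3, h3'] at h0
    simp at h0
  · rw [h1, h1', h3] at h0
    simp at h0
  · exact ⟨by rw [h1', h3'], by rw [h1, h3]⟩

/-- `meet l m` is the one and only common point of two lines that are not parallel. -/
theorem contains_iff_eq_meet {l m : Line k} (h : ¬ l.Parallel m) (p : k × k) :
    l.Contains p ∧ m.Contains p ↔ p = meet l m := by
  have hd := det_ne_zero h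
  constructor
  · rintro ⟨h1, h3⟩
    unfold Contains at h1 h3
    refine Prod.ext ?_ ?_
    · simp only [meet]
      rw [eq_div_iff hd]
      linear_combination l.u * h3 - m.u * h1
    · simp only [meet]
      rw [eq_div_iff hd]
      linear_combination l.t * h3 - m.t * h1
  · rintro rfl
    constructor
    · simp only [Contains, meet]
      rw [mul_div_assoc', mul_div_assoc', ← sub_div, div_add' _ _ _ hd, div_eq_zero_iff]
      left
      ring
    · simp only [Contains, meet]
      rw [mul_div_assoc', mul_div_assoc', ← sub_div, div_add' _ _ _ hd, div_eq_zero_iff]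
      left
      ring

/-- The translate of the line `l` by the vector `w`. -/
def translate (w : k × k) (l : Line k) : Line k where
  t := l.t
  u := l.u
  v := l.v - l.t * w.1 + l.u * w.2
  canonical := l.canonical

end Line

section Bisectors

variable {k : Type*} [Field k]

/-- The midpoint of two points of the plane (over a field of characteristic other than two). -/
def mid (p q : k × k) : k × k :=
  ((p.1 + q.1) / 2, (p.2 + q.2) / 2)

/-- The line `l` crosses the pair `{a, b}`: it is distinct from both lines of the pair and it is not
the case that both of them are parallel to it. -/
def Crosses (l a b : Line k) : Prop :=
  l ≠ a ∧ l ≠ b ∧ ¬ (l.Parallel a ∧ l.Parallel b)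

open Classical in
/-- The midpoint of the two points in which a line `l` that crosses the pair `{a, b}` meets `a` and
`b`. The value `none` stands for the point at infinity of `l`; this is the midpoint if one of the two
points of intersection is at infinity. -/
noncomputable def crossMid (l a b : Line k) : Option (k × k) :=
  if l.Parallel a ∨ l.Parallel b then none else some (mid (l.meet a) (l.meet b))

/-- The line `l` bisects the collection `S` of (unordered) pairs of lines. The two lines of a pair
may coincide. -/
def Bisects (l : Line k) (S : Set (Sym2 (Line k))) : Prop :=
  ∀ a b a' b' : Line k, s(a, b) ∈ S → s(a', b') ∈ S → Crosses l a b → Crosses l a' b' →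
    crossMid l a b = crossMid l a' b'

/-- The line `l` bisects the collection `S` of pairs, and `m` is its midpoint as a bisector of `S`,
that is, the common midpoint of `l` for the pairs in `S` that `l` crosses. -/
def BisectsWithMidpoint (l : Line k) (m : Option (k × k)) (S : Set (Sym2 (Line k))) : Prop :=
  Bisects l S ∧ ∃ a b : Line k, s(a, b) ∈ S ∧ Crosses l a b ∧ crossMid l a b = m

/-- The lines that occur in the pairs of a collection of pairs of lines. -/
def linesOf (S : Set (Sym2 (Line k))) : Set (Line k) :=
  {l | ∃ P ∈ S, l ∈ P}

/-- A bisector arrangement is a collection of pairs of lines that is bisected by each of its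
lines. -/
def IsBisectorArrangement (S : Set (Sym2 (Line k))) : Prop :=
  ∀ l ∈ linesOf S, Bisects l S

/-- A bisector arrangement is trivial if all its lines go through one point of the plane, or all go
through one point at infinity (that is, are parallel to each other), or every pair in it is a
translate of every other. -/
def IsTrivialArrangement (S : Set (Sym2 (Line k))) : Prop :=
  (∃ p : k × k, ∀ l ∈ linesOf S, l.Contains p) ∨
  (∀ l ∈ linesOf S, ∀ l' ∈ linesOf S, l.Parallel l') ∨
  (∀ P ∈ S, ∀ P' ∈ S, ∃ w : k × k, P' = P.map (Line.translate w))

/-- A bisector field is a nontrivial bisector arrangement that cannot be extended to a larger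
bisector arrangement. -/
def IsBisectorField (S : Set (Sym2 (Line k))) : Prop :=
  IsBisectorArrangement S ∧ ¬ IsTrivialArrangement S ∧
  ∀ T : Set (Sym2 (Line k)), IsBisectorArrangement T → S ⊆ T → T = S

end Bisectors

/-- A quadrilateral `A B A' B'`: four distinct lines, not all through one point, such that adjacent
sides are not parallel (hence distinct, as a line is parallel to itself). The opposite sides are
`A, A'` and `B, B'`; they may be parallel, and three of the sides may go through one point. -/
structure Quadrilateral (k : Type*) [Field k] where
  A : Line k
  B : Line k
  A' : Line k
  B' : Line k
  ne_A : A ≠ A'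
  ne_B : B ≠ B'
  not_parallel_AB : ¬ A.Parallel B
  not_parallel_BA' : ¬ B.Parallel A'
  not_parallel_A'B' : ¬ A'.Parallel B'
  not_parallel_B'A : ¬ B'.Parallel A
  not_concurrent :
    ¬ ∃ p : k × k, A.Contains p ∧ B.Contains p ∧ A'.Contains p ∧ B'.Contains p

namespace Quadrilateral

variable {k : Type*} [Field k]

/-- The two pairs of opposite sides. -/
def oppositeSides (Q : Quadrilateral k) : Set (Sym2 (Line k)) :=
  {s(Q.A, Q.A'), s(Q.B, Q.B')}

/-- The bisectors of `Q`. A bisector of a quadrilateral is understood to be the line together with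
its midpoint. -/
def bisectors (Q : Quadrilateral k) : Set (Line k × Option (k × k)) :=
  {b | BisectsWithMidpoint b.1 b.2 Q.oppositeSides}

/-- The centroid of `Q`, the midpoint of the midpoints of the diagonals. The diagonals join the
vertex `A ∩ B` with `A' ∩ B'` and the vertex `B ∩ A'` with `B' ∩ A`. -/
def centroid (Q : Quadrilateral k) : k × k :=
  mid (mid (Q.A.meet Q.B) (Q.A'.meet Q.B')) (mid (Q.B.meet Q.A') (Q.B'.meet Q.A))

/-- First coefficient of the inner product of `Q`. -/
def alpha (Q : Quadrilateral k) : k :=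
  Q.A.t * Q.B.u * Q.A'.u * Q.B'.u - Q.A.u * Q.B.t * Q.A'.u * Q.B'.u
    + Q.A.u * Q.B.u * Q.A'.t * Q.B'.u - Q.A.u * Q.B.u * Q.A'.u * Q.B'.t

/-- Second coefficient of the inner product of `Q`. -/
def beta (Q : Quadrilateral k) : k :=
  Q.A.t * Q.B.u * Q.A'.t * Q.B'.u - Q.A.u * Q.B.t * Q.A'.u * Q.B'.t

/-- Third coefficient of the inner product of `Q`. -/
def gamma (Q : Quadrilateral k) : k :=
  Q.A.t * Q.B.t * Q.A'.t * Q.B'.u - Q.A.t * Q.B.t * Q.A'.u * Q.B'.t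
    + Q.A.t * Q.B.u * Q.A'.t * Q.B'.t - Q.A.u * Q.B.t * Q.A'.t * Q.B'.t

/-- The symmetric bilinear form of `Q`, with matrix `!![γ, -β; -β, α]`. -/
def innerQ (Q : Quadrilateral k) (x y : k × k) : k :=
  Q.gamma * x.1 * y.1 - Q.beta * (x.1 * y.2 + x.2 * y.1) + Q.alpha * x.2 * y.2

/-- Two lines are `Q`-orthogonal if their direction vectors are orthogonal for the form of `Q`. -/
def Orthogonal (Q : Quadrilateral k) (l l' : Line k) : Prop :=
  Q.innerQ (l.u, l.t) (l'.u, l'.t) = 0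

/-- The lines `l` and `l'` are bisectors of `Q` that form a `Q`-antipodal pair: the midpoint of
their midpoints is the centroid of `Q`. -/
def Antipodal (Q : Quadrilateral k) (l l' : Line k) : Prop :=
  ∃ p p' : k × k, (l, some p) ∈ Q.bisectors ∧ (l', some p') ∈ Q.bisectors ∧
    mid p p' = Q.centroid

/-- A pair of bisectors of `Q` that is `Q`-antipodal and `Q`-orthogonal. -/
def IsQPair (Q : Quadrilateral k) (l l' : Line k) : Prop :=
  Q.Antipodal l l' ∧ Q.Orthogonal l l'

/-- The bisector field of `Q` is the collection of all `Q`-pairs of bisectors of `Q`. -/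
def bisectorField (Q : Quadrilateral k) : Set (Sym2 (Line k)) :=
  {P | ∃ l l' : Line k, P = s(l, l') ∧ Q.IsQPair l l'}

/-- The collection `S` of pairs of lines is a pairing of the bisectors of `Q`: the lines in its
pairs are the bisectors of `Q`, and where a bisector of `Q` crosses a pair in `S`, it does so with
its own midpoint. -/
def IsPairing (Q : Quadrilateral k) (S : Set (Sym2 (Line k))) : Prop :=
  linesOf S = Prod.fst '' Q.bisectors ∧
  ∀ l m, (l, m) ∈ Q.bisectors → ∀ a b : Line k, s(a, b) ∈ S → Crosses l a b → crossMid l a b = m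

end Quadrilateral

/-!
A line `l` crosses a pair `{a, b}` in two points whose midpoint is the critical point on `l` of the
product of the equations of `a` and `b` (`crossMid_eq_some`, `dirDeriv_of_crossMid`). The derivative
is linear in the product and does not see additive constants, so the argument takes place in the
five-dimensional space of quadratic functions modulo constants. There a quadrilateral `Q` spans a
pencil: the linear combinations of `A A'` and `B B'`. As adjacent sides are not parallel, the two
binary quadratic forms have no common zero, and the midpoint of a bisector of `Q` is never at
infinity (`mem_bisectors_iff`).

The `Q`-pairs are precisely the pairs `{l, l'}` whose product lies in the pencil (`isQPair_iff`).
If the product lies in the pencil, then `l` and `l'` are orthogonal because the form of `Q` is apolar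
to the pencil. They are antipodal because the midpoint of their midpoints is the centre of the
conic defined by the Jacobian of the pencil (`jacobianGrad_mid`); applied to `A` and `A'`, the same
argument shows that this centre is the centroid. Conversely, some member of the pencil is constant
on a given bisector `l`, which gives `l` a partner (`IsBisectorAt.exists_partner`), and a line that is
orthogonal and antipodal to `l` has to be that partner, since the form of `Q` is nondegenerate.

The pencil can be recovered from the bisectors with their midpoints: it consists of the quadratic
functions that are critical on each bisector at its midpoint (`inPencil_of_dirDeriv_eq_zero`). Hence
the bisector field of `Q` is a maximal bisector arrangement. Finally, the union of two pairings of
the bisectors of `Q` is again a bisector arrangement, so maximality forces any pairing that is a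
bisector field to be the bisector field of `Q`. The first part of the theorem follows from this.
-/

open Line

/-! ### Lines and quadratic functions modulo constants -/

section QuadraticFunctions

variable {k : Type*} [Field k]

/-- The value at `p` of the left-hand side of the canonical equation of `l`. -/
def lineEval (l : Line k) (p : k × k) : k := l.t * p.1 - l.u * p.2 + l.v

/-- The direction vector of a line. -/
def lineDir (l : Line k) : k × k := (l.u, l.t)

/-- The derivative of the equation of `a` along the direction vector of `l`; it vanishes precisely
if the lines are parallel. -/
def lineDet (a l : Line k) : k := a.t * l.u - a.u * l.t

theorem lineEval_eq_zero {l : Line k} {p : k × k} : lineEval l p = 0 ↔ l.Contains p := Iff.rfl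

theorem lineDet_ne_zero {a l : Line k} (h : ¬ a.Parallel l) : lineDet a l ≠ 0 := by
  intro h0
  apply det_ne_zero h
  unfold lineDet at h0
  linear_combination -h0

theorem lineDet_eq_zero_iff {a l : Line k} : lineDet a l = 0 ↔ l.Parallel a := by
  constructor
  · intro h
    by_contra h1
    exact lineDet_ne_zero (fun h2 => h1 ⟨h2.1.symm, h2.2.symm⟩) h
  · rintro ⟨h1, h2⟩
    simp only [lineDet, h1, h2]
    ring

theorem Line.Parallel.symm {l m : Line k} (h : l.Parallel m) : m.Parallel l :=
  ⟨h.1.symm, h.2.symm⟩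

theorem Line.Parallel.trans {l m n : Line k} (h : l.Parallel m) (h' : m.Parallel n) :
    l.Parallel n :=
  ⟨h.1.trans h'.1, h.2.trans h'.2⟩

/-- Parallel lines with a common point are equal. -/
theorem Line.Parallel.eq_of_contains {l m : Line k} (h : l.Parallel m) {p : k × k}
    (hl : l.Contains p) (hm : m.Contains p) : l = m := by
  refine Line.ext h.1 h.2 ?_
  unfold Line.Contains at hl hm
  linear_combination hl - hm - p.1 * h.1 + p.2 * h.2

/-- Two points of a line differ by a multiple of the direction vector. -/
theorem Line.Contains.exists_add_smul {l : Line k} {p q : k × k} (hp : l.Contains p)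
    (hq : l.Contains q) : ∃ s : k, q = (p.1 + s * l.u, p.2 + s * l.t) := by
  unfold Line.Contains at hp hq
  rcases l.canonical with h | ⟨h, h'⟩
  · refine ⟨q.1 - p.1, Prod.ext ?_ ?_⟩
    · rw [h]; simp
    · rw [h] at hp hq
      show q.2 = p.2 + (q.1 - p.1) * l.t
      linear_combination hp - hq
  · refine ⟨q.2 - p.2, Prod.ext ?_ ?_⟩
    · rw [h, h'] at hp hq
      show q.1 = p.1 + (q.2 - p.2) * l.u
      rw [h]
      linear_combination hq - hp
    · rw [h']; simp

theorem Line.exists_contains (l : Line k) : ∃ p, l.Contains p := by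
  unfold Line.Contains
  rcases l.canonical with h | ⟨h, h'⟩
  · exact ⟨(0, l.v), by simp [h]⟩
  · exact ⟨(-l.v, 0), by simp [h']⟩

/-- A quadratic function `q₀ X² + q₁ XY + q₂ Y² + q₃ X + q₄ Y` on the plane, up to an additive
constant. -/
abbrev QuadFun (k : Type*) := Fin 5 → k

/-- The derivative of the quadratic function `q` at `p` in the direction `w`. -/
def dirDeriv (q : QuadFun k) (w p : k × k) : k :=
  w.1 * (2 * q 0 * p.1 + q 1 * p.2 + q 3) + w.2 * (q 1 * p.1 + 2 * q 2 * p.2 + q 4)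

/-- The value at `w` of the homogeneous part of degree two of `q`. -/
def lead (q : QuadFun k) (w : k × k) : k :=
  q 0 * w.1 ^ 2 + q 1 * w.1 * w.2 + q 2 * w.2 ^ 2

/-- The product of the equation of the line `l` with the function `m.1 X + m.2.1 Y + m.2.2`. -/
def mulAffine (l : Line k) (m : k × k × k) : QuadFun k :=
  ![l.t * m.1, l.t * m.2.1 - l.u * m.1, -(l.u * m.2.1), l.t * m.2.2 + l.v * m.1,
    l.v * m.2.1 - l.u * m.2.2]

/-- The product of the equations of two lines. -/
def lineMul (a b : Line k) : QuadFun k := mulAffine a (b.t, -b.u, b.v)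

theorem lineMul_comm (a b : Line k) : lineMul a b = lineMul b a := by
  ext i
  fin_cases i <;> simp [lineMul, mulAffine] <;> ring

theorem lineMul_congr {a b c d : Line k} (h : s(a, b) = s(c, d)) :
    lineMul a b = lineMul c d := by
  rcases Sym2.eq_iff.1 h with ⟨rfl, rfl⟩ | ⟨rfl, rfl⟩
  · rfl
  · exact lineMul_comm _ _

theorem dirDeriv_comb (x y : k) (q r : QuadFun k) (w p : k × k) :
    dirDeriv (x • q + y • r) w p = x * dirDeriv q w p + y * dirDeriv r w p := by
  simp only [dirDeriv, Pi.add_apply, Pi.smul_apply, smul_eq_mul]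
  ring

theorem lead_comb (x y : k) (q r : QuadFun k) (w : k × k) :
    lead (x • q + y • r) w = x * lead q w + y * lead r w := by
  simp only [lead, Pi.add_apply, Pi.smul_apply, smul_eq_mul]
  ring

theorem dirDeriv_mulAffine (a l : Line k) (m : k × k × k) (p : k × k) :
    dirDeriv (mulAffine a m) (lineDir l) p =
      lineDet a l * (m.1 * p.1 + m.2.1 * p.2 + m.2.2) +
        (m.1 * l.u + m.2.1 * l.t) * lineEval a p := by
  simp [dirDeriv, mulAffine, lineDir, lineDet, lineEval]
  ring

theorem lead_mulAffine (a l : Line k) (m : k × k × k) :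
    lead (mulAffine a m) (lineDir l) = lineDet a l * (m.1 * l.u + m.2.1 * l.t) := by
  simp [lead, mulAffine, lineDir, lineDet]
  ring

theorem dirDeriv_lineMul (a b l : Line k) (p : k × k) :
    dirDeriv (lineMul a b) (lineDir l) p =
      lineDet a l * lineEval b p + lineDet b l * lineEval a p := by
  rw [lineMul, dirDeriv_mulAffine]
  simp only [lineDet, lineEval]
  ring

theorem lead_lineMul (a b l : Line k) :
    lead (lineMul a b) (lineDir l) = lineDet a l * lineDet b l := by
  rw [lineMul, lead_mulAffine]
  simp only [lineDet]
  ring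

theorem dirDeriv_add_smul (q : QuadFun k) (l : Line k) (p : k × k) (s : k) :
    dirDeriv q (lineDir l) (p.1 + s * l.u, p.2 + s * l.t) =
      dirDeriv q (lineDir l) p + 2 * s * lead q (lineDir l) := by
  simp only [dirDeriv, lead, lineDir]
  ring

theorem lineEval_add_smul (a l : Line k) (p : k × k) (s : k) :
    lineEval a (p.1 + s * l.u, p.2 + s * l.t) = lineEval a p + s * lineDet a l := by
  simp only [lineEval, lineDet]
  ring

theorem lineDet_self (l : Line k) : lineDet l l = 0 := by
  simp only [lineDet]; ring

/-- A product of two lines has a nonzero homogeneous part of degree two. -/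
theorem lineMul_ne_zero (a b : Line k) : lineMul a b ≠ 0 := by
  intro h
  have h0 := congrFun h 0
  have h1 := congrFun h 1
  have h2 := congrFun h 2
  simp [lineMul, mulAffine] at h0 h1 h2
  rcases a.canonical with ha | ⟨ha, ha'⟩ <;> rcases b.canonical with hb | ⟨hb, hb'⟩ <;>
    simp_all

/-- A quadratic function that is constant on a line `l` is, up to a constant, divisible by the
equation of `l`. -/
theorem exists_eq_mulAffine {q : QuadFun k} {l : Line k} {p : k × k} (hp : l.Contains p)
    (hq : lead q (lineDir l) = 0) (hs : dirDeriv q (lineDir l) p = 0) :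
    ∃ m : k × k × k, q = mulAffine l m := by
  unfold Line.Contains at hp
  simp only [lead, dirDeriv, lineDir] at hq hs
  rcases l.canonical with h | ⟨h, h'⟩
  · rw [h] at hp hq hs
    refine ⟨(-l.t * q 2 - q 1, -q 2, -l.v * q 2 - q 4), ?_⟩
    ext i
    fin_cases i <;> simp [mulAffine, h]
    · linear_combination hq
    · linear_combination hs - 2 * p.1 * hq + (2 * l.t * q 2 + q 1) * hp
  · rw [h, h'] at hp hq hs
    refine ⟨(q 0, q 1, q 3 - l.v * q 0), ?_⟩
    ext i
    fin_cases i <;> simp [mulAffine, h, h']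
    · linear_combination hq
    · linear_combination hs - 2 * p.2 * hq - q 1 * hp

/-- A nonconstant affine function is a multiple of the equation of a line. -/
theorem exists_line_of_affine {m : k × k × k} (h : ¬ (m.1 = 0 ∧ m.2.1 = 0)) :
    ∃ (c : k) (b : Line k), c ≠ 0 ∧ m = (c * b.t, -(c * b.u), c * b.v) := by
  by_cases h2 : m.2.1 = 0
  · have h1 : m.1 ≠ 0 := fun h1 => h ⟨h1, h2⟩
    refine ⟨m.1, ⟨1, 0, m.2.2 / m.1, Or.inr ⟨rfl, rfl⟩⟩, h1, ?_⟩
    ext <;> simp [h2]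
    field_simp
  · refine ⟨-m.2.1, ⟨-m.1 / m.2.1, 1, -m.2.2 / m.2.1, Or.inl rfl⟩, neg_ne_zero.2 h2, ?_⟩
    ext <;> simp <;> field_simp

theorem mulAffine_eq_smul (a b : Line k) (c : k) :
    mulAffine a (c * b.t, -(c * b.u), c * b.v) = c • lineMul a b := by
  ext i
  fin_cases i <;> simp [lineMul, mulAffine] <;> ring

/-- An affine function that vanishes on the line `b` is a multiple of its equation. -/
theorem affine_eq_of_vanish {m : k × k × k} {b : Line k} {p : k × k} (hp : b.Contains p)
    (hd : m.1 * b.u + m.2.1 * b.t = 0) (hm : m.1 * p.1 + m.2.1 * p.2 + m.2.2 = 0) :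
    ∃ c : k, m = (c * b.t, -(c * b.u), c * b.v) := by
  unfold Line.Contains at hp
  rcases b.canonical with h | ⟨h, h'⟩
  · rw [h] at hp hd
    refine ⟨-m.2.1, ?_⟩
    ext
    · show m.1 = _
      linear_combination hd
    · simp [h]
    · show m.2.2 = _
      linear_combination hm - p.1 * hd + m.2.1 * hp
  · rw [h, h'] at hp hd
    refine ⟨m.1, ?_⟩
    ext
    · simp [h']
    · show m.2.1 = _
      rw [h]
      linear_combination hd
    · show m.2.2 = _
      linear_combination hm - p.2 * hd - m.1 * hp

/-! ### Midpoints as zeros of a derivative -/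

theorem lead_eq_zero_of_not_crosses {l a b : Line k} (h : ¬ Crosses l a b) :
    lead (lineMul a b) (lineDir l) = 0 := by
  rw [lead_lineMul]
  by_cases ha : l = a
  · rw [← ha, lineDet_self, zero_mul]
  by_cases hb : l = b
  · rw [← hb, lineDet_self, mul_zero]
  have h1 : l.Parallel a ∧ l.Parallel b := by
    by_contra h1
    exact h ⟨ha, hb, h1⟩
  rw [lineDet_eq_zero_iff.2 h1.1, zero_mul]

theorem dirDeriv_eq_zero_of_not_crosses {l a b : Line k} (h : ¬ Crosses l a b) {p : k × k}
    (hp : l.Contains p) : dirDeriv (lineMul a b) (lineDir l) p = 0 := by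
  rw [dirDeriv_lineMul]
  by_cases ha : l = a
  · rw [← ha, lineDet_self, lineEval_eq_zero.2 hp]; ring
  by_cases hb : l = b
  · rw [← hb, lineDet_self, lineEval_eq_zero.2 hp]; ring
  have h1 : l.Parallel a ∧ l.Parallel b := by
    by_contra h1
    exact h ⟨ha, hb, h1⟩
  rw [lineDet_eq_zero_iff.2 h1.1, lineDet_eq_zero_iff.2 h1.2]; ring

theorem crossMid_eq_none_iff {l a b : Line k} :
    crossMid l a b = none ↔ lead (lineMul a b) (lineDir l) = 0 := by
  rw [lead_lineMul, mul_eq_zero, lineDet_eq_zero_iff, lineDet_eq_zero_iff]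
  unfold crossMid
  split_ifs with h <;> simp [h]

/-- The midpoint of the intersections of `l` with `a` and `b` is a critical point on `l` of the
product of `a` and `b`. -/
theorem dirDeriv_mid (h2 : (2 : k) ≠ 0) {l a b : Line k} {p q : k × k} (hlp : l.Contains p)
    (hap : a.Contains p) (hlq : l.Contains q) (hbq : b.Contains q) :
    l.Contains (mid p q) ∧ dirDeriv (lineMul a b) (lineDir l) (mid p q) = 0 := by
  obtain ⟨s, rfl⟩ := hlp.exists_add_smul hlq
  have hm : mid p (p.1 + s * l.u, p.2 + s * l.t) = (p.1 + s / 2 * l.u, p.2 + s / 2 * l.t) := by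
    ext <;> simp only [mid] <;> field_simp <;> ring
  rw [← lineEval_eq_zero] at *
  rw [lineEval_add_smul] at hbq
  rw [hm, dirDeriv_lineMul, lineEval_add_smul, lineEval_add_smul, lineEval_add_smul, lineDet_self,
    hlp, hap]
  refine ⟨by ring, ?_⟩
  have h3 : s = s / 2 + s / 2 := by field_simp; ring
  generalize s / 2 = r at *
  subst h3
  linear_combination lineDet a l * hbq

theorem eq_of_dirDeriv_eq_zero (h2 : (2 : k) ≠ 0) {l : Line k} {q : QuadFun k} {p p' : k × k}
    (hp : l.Contains p) (hp' : l.Contains p') (hq : lead q (lineDir l) ≠ 0)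
    (hs : dirDeriv q (lineDir l) p = 0) (hs' : dirDeriv q (lineDir l) p' = 0) : p = p' := by
  obtain ⟨s, rfl⟩ := hp.exists_add_smul hp'
  rw [dirDeriv_add_smul, hs, zero_add] at hs'
  have : s = 0 := by simpa [h2, hq] using hs'
  simp [this]

theorem exists_dirDeriv_eq_zero (h2 : (2 : k) ≠ 0) {l : Line k} {q : QuadFun k}
    (hq : lead q (lineDir l) ≠ 0) : ∃ p, l.Contains p ∧ dirDeriv q (lineDir l) p = 0 := by
  obtain ⟨p, hp⟩ := l.exists_contains
  refine ⟨(p.1 + -dirDeriv q (lineDir l) p / (2 * lead q (lineDir l)) * l.u,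
    p.2 + -dirDeriv q (lineDir l) p / (2 * lead q (lineDir l)) * l.t), ?_, ?_⟩
  · rw [← lineEval_eq_zero, lineEval_add_smul, lineDet_self, lineEval_eq_zero.2 hp]; ring
  · rw [dirDeriv_add_smul]
    field_simp
    ring

theorem crossMid_eq_some (h2 : (2 : k) ≠ 0) {l a b : Line k} (h : Crosses l a b) {p : k × k}
    (hp : l.Contains p) (hs : dirDeriv (lineMul a b) (lineDir l) p = 0) :
    crossMid l a b = some p := by
  rw [dirDeriv_lineMul] at hs
  by_cases ha : l.Parallel a
  · exfalso
    have hb : lineDet b l ≠ 0 := fun h0 => h.2.2 ⟨ha, lineDet_eq_zero_iff.1 h0⟩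
    rw [lineDet_eq_zero_iff.2 ha, zero_mul, zero_add] at hs
    exact h.1 (ha.eq_of_contains hp ((mul_eq_zero.1 hs).resolve_left hb))
  by_cases hb : l.Parallel b
  · exfalso
    have ha : lineDet a l ≠ 0 := fun h0 => ha (lineDet_eq_zero_iff.1 h0)
    rw [lineDet_eq_zero_iff.2 hb, zero_mul, add_zero] at hs
    exact h.2.1 (hb.eq_of_contains hp ((mul_eq_zero.1 hs).resolve_left ha))
  have h3 := (contains_iff_eq_meet ha _).2 rfl
  have h4 := (contains_iff_eq_meet hb _).2 rfl
  have h5 := dirDeriv_mid h2 h3.1 h3.2 h4.1 h4.2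
  have h6 : lead (lineMul a b) (lineDir l) ≠ 0 := by
    rw [lead_lineMul]
    exact mul_ne_zero (fun h0 => ha (lineDet_eq_zero_iff.1 h0))
      (fun h0 => hb (lineDet_eq_zero_iff.1 h0))
  rw [crossMid, if_neg (by tauto), eq_of_dirDeriv_eq_zero h2 hp h5.1 h6 (by rwa [dirDeriv_lineMul]) h5.2]

theorem dirDeriv_of_crossMid (h2 : (2 : k) ≠ 0) {l a b : Line k} {p : k × k}
    (h : crossMid l a b = some p) :
    l.Contains p ∧ dirDeriv (lineMul a b) (lineDir l) p = 0 := by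
  unfold crossMid at h
  split_ifs at h with h1
  rw [not_or] at h1
  have h3 := (contains_iff_eq_meet h1.1 _).2 rfl
  have h4 := (contains_iff_eq_meet h1.2 _).2 rfl
  have h5 := dirDeriv_mid h2 h3.1 h3.2 h4.1 h4.2
  rwa [← Option.some.inj h]

end QuadraticFunctions

/-! ### The pencil of a quadrilateral -/

namespace Quadrilateral

variable {k : Type*} [Field k]

/-- The quadratic function `q` is, up to a constant, a linear combination of the products of the two
pairs of opposite sides of `Q`. -/
def InPencil (Q : Quadrilateral k) (q : QuadFun k) : Prop :=
  ∃ x y : k, q = x • lineMul Q.A Q.A' + y • lineMul Q.B Q.B'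

/-- The line `l` is a bisector of `Q` with midpoint `p`, expressed by derivatives along `l`. -/
def IsBisectorAt (Q : Quadrilateral k) (l : Line k) (p : k × k) : Prop :=
  l.Contains p ∧ dirDeriv (lineMul Q.A Q.A') (lineDir l) p = 0 ∧
    dirDeriv (lineMul Q.B Q.B') (lineDir l) p = 0

/-- The binary quadratic forms of the two pairs of opposite sides have no common zero. -/
theorem lead_ne_zero (Q : Quadrilateral k) (l : Line k) :
    lead (lineMul Q.A Q.A') (lineDir l) ≠ 0 ∨ lead (lineMul Q.B Q.B') (lineDir l) ≠ 0 := by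
  rw [← not_and_or]
  simp only [lead_lineMul, mul_eq_zero, lineDet_eq_zero_iff]
  rintro ⟨h1 | h1, h2 | h2⟩
  · exact Q.not_parallel_AB (h1.symm.trans h2)
  · exact Q.not_parallel_B'A (h2.symm.trans h1)
  · exact Q.not_parallel_BA' (h2.symm.trans h1)
  · exact Q.not_parallel_A'B' (h1.symm.trans h2)

theorem IsBisectorAt.crossMid_eq (h2 : (2 : k) ≠ 0) {Q : Quadrilateral k} {l a b : Line k}
    {p : k × k} (h : Q.IsBisectorAt l p) (hq : Q.InPencil (lineMul a b)) (hc : Crosses l a b) :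
    crossMid l a b = some p := by
  refine crossMid_eq_some h2 hc h.1 ?_
  obtain ⟨x, y, hxy⟩ := hq
  rw [hxy, dirDeriv_comb, h.2.1, h.2.2]
  ring

theorem inPencil_AA' (Q : Quadrilateral k) : Q.InPencil (lineMul Q.A Q.A') :=
  ⟨1, 0, by simp⟩

theorem inPencil_BB' (Q : Quadrilateral k) : Q.InPencil (lineMul Q.B Q.B') :=
  ⟨0, 1, by simp⟩

theorem inPencil_of_mem_oppositeSides {Q : Quadrilateral k} {a b : Line k}
    (h : s(a, b) ∈ Q.oppositeSides) : Q.InPencil (lineMul a b) := by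
  rcases h with h | h
  · rw [lineMul_congr h]; exact Q.inPencil_AA'
  · rw [lineMul_congr (Set.mem_singleton_iff.1 h)]; exact Q.inPencil_BB'

theorem exists_crosses (Q : Quadrilateral k) (l : Line k) :
    ∃ a b, s(a, b) ∈ Q.oppositeSides ∧ Crosses l a b := by
  rcases Q.lead_ne_zero l with h | h
  · exact ⟨Q.A, Q.A', Or.inl rfl, not_imp_comm.1 lead_eq_zero_of_not_crosses h⟩
  · exact ⟨Q.B, Q.B', Or.inr rfl, not_imp_comm.1 lead_eq_zero_of_not_crosses h⟩

/-- A line that bisects some collection containing the opposite sides of `Q` has its midpoint with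
respect to `Q` in the plane, and this point is critical for each product of a pair in the
collection. -/
theorem exists_of_bisects (h2 : (2 : k) ≠ 0) (Q : Quadrilateral k) {l : Line k}
    {T : Set (Sym2 (Line k))} (hT : Q.oppositeSides ⊆ T) (hl : Bisects l T) :
    ∃ p, Q.IsBisectorAt l p ∧ ∀ a b, s(a, b) ∈ T → dirDeriv (lineMul a b) (lineDir l) p = 0 := by
  have key : ∃ p, l.Contains p ∧
      ∀ a b, s(a, b) ∈ T → dirDeriv (lineMul a b) (lineDir l) p = 0 := by
    obtain ⟨c, d, hcd, hne⟩ :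
        ∃ c d, s(c, d) ∈ T ∧ lead (lineMul c d) (lineDir l) ≠ 0 := by
      rcases Q.lead_ne_zero l with h | h
      · exact ⟨_, _, hT (Or.inl rfl), h⟩
      · exact ⟨_, _, hT (Or.inr rfl), h⟩
    have hc : Crosses l c d := not_imp_comm.1 lead_eq_zero_of_not_crosses hne
    obtain ⟨p, hp⟩ := Option.ne_none_iff_exists'.1 (mt crossMid_eq_none_iff.1 hne)
    have hp' := dirDeriv_of_crossMid h2 hp
    refine ⟨p, hp'.1, fun a b hab => ?_⟩
    by_cases h : Crosses l a b
    · exact (dirDeriv_of_crossMid h2 ((hl a b c d hab hcd h hc).trans hp)).2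
    · exact dirDeriv_eq_zero_of_not_crosses h hp'.1
  obtain ⟨p, hp, h⟩ := key
  exact ⟨p, ⟨hp, h _ _ (hT (Or.inl rfl)), h _ _ (hT (Or.inr rfl))⟩, h⟩

theorem mem_bisectors_iff (h2 : (2 : k) ≠ 0) (Q : Quadrilateral k) {l : Line k}
    {m : Option (k × k)} : (l, m) ∈ Q.bisectors ↔ ∃ p, m = some p ∧ Q.IsBisectorAt l p := by
  constructor
  · rintro ⟨hl, a, b, hab, hc, hm⟩
    obtain ⟨p, hp, -⟩ := Q.exists_of_bisects h2 subset_rfl hl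
    exact ⟨p, hm.symm.trans (hp.crossMid_eq h2 (inPencil_of_mem_oppositeSides hab) hc), hp⟩
  · rintro ⟨p, rfl, hp⟩
    obtain ⟨a, b, hab, hc⟩ := Q.exists_crosses l
    refine ⟨fun a b a' b' h h' hc hc' => ?_, a, b, hab, hc,
      hp.crossMid_eq h2 (inPencil_of_mem_oppositeSides hab) hc⟩
    rw [hp.crossMid_eq h2 (inPencil_of_mem_oppositeSides h) hc,
      hp.crossMid_eq h2 (inPencil_of_mem_oppositeSides h') hc']

theorem IsBisectorAt.unique (h2 : (2 : k) ≠ 0) {Q : Quadrilateral k} {l : Line k} {p p' : k × k}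
    (h : Q.IsBisectorAt l p) (h' : Q.IsBisectorAt l p') : p = p' := by
  rcases Q.lead_ne_zero l with h0 | h0
  · exact eq_of_dirDeriv_eq_zero h2 h.1 h'.1 h0 h.2.1 h'.2.1
  · exact eq_of_dirDeriv_eq_zero h2 h.1 h'.1 h0 h.2.2 h'.2.2

/-- The homogeneous parts of degree two of the products of opposite sides are linearly
independent. -/
theorem eq_zero_of_lead_comb {Q : Quadrilateral k} {x y : k}
    (h : ∀ l, lead (x • lineMul Q.A Q.A' + y • lineMul Q.B Q.B') (lineDir l) = 0) :
    x = 0 ∧ y = 0 := by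
  have hA := h Q.A
  have hB := h Q.B
  have hA' := Q.lead_ne_zero Q.A
  have hB' := Q.lead_ne_zero Q.B
  rw [lead_comb] at hA hB
  simp only [lead_lineMul, lineDet_self, zero_mul, mul_zero, zero_add, add_zero, ne_eq,
    not_true_eq_false, false_or, or_false, mul_eq_zero] at hA hB hA' hB'
  tauto

/-- Every bisector of `Q` is part of a pair in the pencil of `Q`: some member of the pencil is
constant on the bisector. -/
theorem IsBisectorAt.exists_partner {Q : Quadrilateral k} {l : Line k}
    {p : k × k} (h : Q.IsBisectorAt l p) : ∃ l', Q.InPencil (lineMul l l') := by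
  set x := lead (lineMul Q.B Q.B') (lineDir l) with hx
  set y := -lead (lineMul Q.A Q.A') (lineDir l) with hy
  obtain ⟨m, hm⟩ := exists_eq_mulAffine (q := x • lineMul Q.A Q.A' + y • lineMul Q.B Q.B') h.1
    (by rw [lead_comb, ← hx, ← neg_eq_iff_eq_neg.2 hy]; ring)
    (by rw [dirDeriv_comb, h.2.1, h.2.2]; ring)
  have hm0 : ¬ (m.1 = 0 ∧ m.2.1 = 0) := by
    rintro ⟨h1, h3⟩
    have h4 : x = 0 ∧ y = 0 := by
      apply eq_zero_of_lead_comb (Q := Q)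
      intro l'
      rw [hm, lead_mulAffine, h1, h3]
      ring
    rcases Q.lead_ne_zero l with h5 | h5
    · exact h5 (neg_eq_zero.1 h4.2)
    · exact h5 h4.1
  obtain ⟨c, l', hc, rfl⟩ := exists_line_of_affine hm0
  rw [mulAffine_eq_smul] at hm
  refine ⟨l', c⁻¹ * x, c⁻¹ * y, ?_⟩
  rw [mul_smul, mul_smul, ← smul_add, hm, inv_smul_smul₀ hc]

/-- Each line of a pair in the pencil of `Q` is a bisector of `Q`. -/
theorem InPencil.exists_isBisectorAt (h2 : (2 : k) ≠ 0) {Q : Quadrilateral k} {l l' : Line k}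
    (h : Q.InPencil (lineMul l l')) : ∃ p, Q.IsBisectorAt l p := by
  obtain ⟨x, y, hxy⟩ := h
  have hl : x * lead (lineMul Q.A Q.A') (lineDir l) +
      y * lead (lineMul Q.B Q.B') (lineDir l) = 0 := by
    rw [← lead_comb, ← hxy, lead_lineMul, lineDet_self, zero_mul]
  have hs : ∀ p, l.Contains p → x * dirDeriv (lineMul Q.A Q.A') (lineDir l) p +
      y * dirDeriv (lineMul Q.B Q.B') (lineDir l) p = 0 := by
    intro p hp
    rw [← dirDeriv_comb, ← hxy, dirDeriv_lineMul, lineDet_self, lineEval_eq_zero.2 hp]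
    ring
  have hne : ¬ (x = 0 ∧ y = 0) := by
    rintro ⟨rfl, rfl⟩
    exact lineMul_ne_zero l l' (by simpa using hxy)
  rcases Q.lead_ne_zero l with h0 | h0
  · obtain ⟨p, hp, hp0⟩ := exists_dirDeriv_eq_zero h2 h0
    have hy : y ≠ 0 := by
      rintro rfl
      simp_all
    refine ⟨p, hp, hp0, ?_⟩
    have := hs p hp
    simpa [hp0, hy] using this
  · obtain ⟨p, hp, hp0⟩ := exists_dirDeriv_eq_zero h2 h0
    have hx : x ≠ 0 := by
      rintro rfl
      simp_all
    refine ⟨p, hp, ?_, hp0⟩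
    have := hs p hp
    simpa [hp0, hx] using this

end Quadrilateral

/-! ### The centre of the Jacobian conic -/

section Jacobian

variable {k : Type*} [Field k]

/-- The partial derivatives at `z` of the Jacobian determinant of the quadratic functions `q` and
`r`. Both vanish if and only if `z` is the centre of the conic that the Jacobian defines. -/
def jacobianGrad (q r : QuadFun k) (z : k × k) : k × k :=
  (4 * (q 0 * r 1 - q 1 * r 0) * z.1 + 4 * (q 0 * r 2 - q 2 * r 0) * z.2 +
      2 * (q 0 * r 4 - q 4 * r 0) + (q 3 * r 1 - q 1 * r 3),
    4 * (q 0 * r 2 - q 2 * r 0) * z.1 + 4 * (q 1 * r 2 - q 2 * r 1) * z.2 +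
      (q 1 * r 4 - q 4 * r 1) + 2 * (q 3 * r 2 - q 2 * r 3))

theorem jacobianGrad_left (x y : k) (q r : QuadFun k) (z : k × k) :
    jacobianGrad (x • q + y • r) r z = x • jacobianGrad q r z := by
  ext <;> simp [jacobianGrad] <;> ring

theorem jacobianGrad_right (x y : k) (q r : QuadFun k) (z : k × k) :
    jacobianGrad (x • q + y • r) q z = -(y • jacobianGrad q r z) := by
  ext <;> simp [jacobianGrad] <;> ring

theorem jacobianGrad_mid_eq (h2 : (2 : k) ≠ 0) (q r : QuadFun k) (p p' : k × k) :
    jacobianGrad q r (mid p p') =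
      (2 * (q 0 * r 1 - q 1 * r 0) * (p.1 + p'.1) + 2 * (q 0 * r 2 - q 2 * r 0) * (p.2 + p'.2) +
        2 * (q 0 * r 4 - q 4 * r 0) + (q 3 * r 1 - q 1 * r 3),
      2 * (q 0 * r 2 - q 2 * r 0) * (p.1 + p'.1) + 2 * (q 1 * r 2 - q 2 * r 1) * (p.2 + p'.2) +
        (q 1 * r 4 - q 4 * r 1) + 2 * (q 3 * r 2 - q 2 * r 3)) := by
  ext <;> simp only [jacobianGrad, mid] <;> field_simp <;> ring

/-- The Jacobian of `L L'` and `r` is `L ∂'r + L' ∂r`, where `∂` and `∂'` are the derivatives along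
the lines `L = 0` and `L' = 0`. Differentiating this at the midpoint of a common zero of `L` and
`∂r` and a common zero of `L'` and `∂'r`, one is left with a multiple of `∂∂'r - ∂'∂r`; so this
midpoint is the centre of the Jacobian conic. -/
theorem jacobianGrad_mid (h2 : (2 : k) ≠ 0) {l l' : Line k} {r : QuadFun k} {p p' : k × k}
    (hp : l.Contains p) (hp' : l'.Contains p') (hs : dirDeriv r (lineDir l) p = 0)
    (hs' : dirDeriv r (lineDir l') p' = 0) : jacobianGrad (lineMul l l') r (mid p p') = 0 := by
  rw [jacobianGrad_mid_eq h2]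
  simp only [Line.Contains, dirDeriv, lineDir] at hp hp' hs hs'
  ext
  · simp [lineMul, mulAffine]
    linear_combination l.t * hs' + (2 * r 0 * l'.u + r 1 * l'.t) * hp + l'.t * hs +
      (2 * r 0 * l.u + r 1 * l.t) * hp'
  · simp [lineMul, mulAffine]
    linear_combination -l.u * hs' + (r 1 * l'.u + 2 * r 2 * l'.t) * hp - l'.u * hs +
      (r 1 * l.u + 2 * r 2 * l.t) * hp'

end Jacobian

/-! ### Pairs in the pencil are the `Q`-pairs -/

namespace Quadrilateral

variable {k : Type*} [Field k]

/-- The form of `Q` is nondegenerate: up to sign, its determinant is the resultant of the two binary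
quadratic forms given by the pairs of opposite sides. -/
theorem form_det_ne_zero (Q : Quadrilateral k) : Q.alpha * Q.gamma - Q.beta ^ 2 ≠ 0 := by
  have h : Q.alpha * Q.gamma - Q.beta ^ 2 =
      -(lineDet Q.A Q.B * lineDet Q.B Q.A' * lineDet Q.A' Q.B' * lineDet Q.B' Q.A) := by
    simp only [alpha, beta, gamma, lineDet]
    ring
  rw [h]
  exact neg_ne_zero.2 (mul_ne_zero (mul_ne_zero (mul_ne_zero
    (lineDet_ne_zero Q.not_parallel_AB) (lineDet_ne_zero Q.not_parallel_BA'))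
    (lineDet_ne_zero Q.not_parallel_A'B')) (lineDet_ne_zero Q.not_parallel_B'A))

theorem jacobianGrad_eq (Q : Quadrilateral k) (z z' : k × k) :
    jacobianGrad (lineMul Q.A Q.A') (lineMul Q.B Q.B') z -
      jacobianGrad (lineMul Q.A Q.A') (lineMul Q.B Q.B') z' =
    (4 * (Q.beta * (z.2 - z'.2) - Q.gamma * (z.1 - z'.1)),
      4 * (Q.beta * (z.1 - z'.1) - Q.alpha * (z.2 - z'.2))) := by
  ext <;> simp [jacobianGrad, lineMul, mulAffine, alpha, beta, gamma] <;> ring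

/-- The Jacobian conic of the pencil of `Q` has only one centre. -/
theorem center_unique (h2 : (2 : k) ≠ 0) (Q : Quadrilateral k) {z z' : k × k}
    (h : jacobianGrad (lineMul Q.A Q.A') (lineMul Q.B Q.B') z = 0)
    (h' : jacobianGrad (lineMul Q.A Q.A') (lineMul Q.B Q.B') z' = 0) : z = z' := by
  have h0 := Q.jacobianGrad_eq z z'
  rw [h, h', sub_zero] at h0
  have h4 : (4 : k) ≠ 0 := by
    have : (4 : k) = 2 * 2 := by norm_num
    rw [this]
    exact mul_ne_zero h2 h2
  have e1 := (mul_eq_zero.1 (congrArg Prod.fst h0).symm).resolve_left h4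
  have e2 := (mul_eq_zero.1 (congrArg Prod.snd h0).symm).resolve_left h4
  ext
  · refine sub_eq_zero.1 ((mul_eq_zero.1 ?_).resolve_left Q.form_det_ne_zero)
    linear_combination -Q.alpha * e1 - Q.beta * e2
  · refine sub_eq_zero.1 ((mul_eq_zero.1 ?_).resolve_left Q.form_det_ne_zero)
    linear_combination -Q.beta * e1 - Q.gamma * e2

theorem jacobianGrad_centroid (h2 : (2 : k) ≠ 0) (Q : Quadrilateral k) :
    jacobianGrad (lineMul Q.A Q.A') (lineMul Q.B Q.B') Q.centroid = 0 := by
  have h1 := (contains_iff_eq_meet Q.not_parallel_AB _).2 rfl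
  have h3 := (contains_iff_eq_meet Q.not_parallel_BA' _).2 rfl
  have h4 := (contains_iff_eq_meet Q.not_parallel_A'B' _).2 rfl
  have h5 := (contains_iff_eq_meet Q.not_parallel_B'A _).2 rfl
  have hA := dirDeriv_mid h2 h1.1 h1.2 h5.2 h5.1
  have hA' := dirDeriv_mid h2 h3.2 h3.1 h4.1 h4.2
  have h := jacobianGrad_mid h2 hA.1 hA'.1 hA.2 hA'.2
  convert h using 2
  ext <;> simp only [centroid, mid] <;> ring

theorem InPencil.mid_eq_centroid (h2 : (2 : k) ≠ 0) {Q : Quadrilateral k} {l l' : Line k}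
    {p p' : k × k} (h : Q.InPencil (lineMul l l')) (hp : Q.IsBisectorAt l p)
    (hp' : Q.IsBisectorAt l' p') : mid p p' = Q.centroid := by
  refine Q.center_unique h2 ?_ (Q.jacobianGrad_centroid h2)
  obtain ⟨x, y, hxy⟩ := h
  have h3 := jacobianGrad_mid h2 hp.1 hp'.1 hp.2.2 hp'.2.2
  have h4 := jacobianGrad_mid h2 hp.1 hp'.1 hp.2.1 hp'.2.1
  rw [hxy, jacobianGrad_left] at h3
  rw [hxy, jacobianGrad_right, neg_eq_zero] at h4
  rcases smul_eq_zero.1 h3 with rfl | h5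
  · rcases smul_eq_zero.1 h4 with rfl | h5
    · exact absurd (by simpa using hxy) (lineMul_ne_zero l l')
    · exact h5
  · exact h5

/-- The form of `Q` is apolar to the binary quadratic forms of both pairs of opposite sides, and
hence to those of all members of the pencil. -/
theorem InPencil.orthogonal {Q : Quadrilateral k} {l l' : Line k}
    (h : Q.InPencil (lineMul l l')) : Q.Orthogonal l l' := by
  obtain ⟨x, y, hxy⟩ := h
  have h1 : Q.innerQ (l.u, l.t) (l'.u, l'.t) =
      Q.gamma * lineMul l l' 2 + Q.beta * lineMul l l' 1 + Q.alpha * lineMul l l' 0 := by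
    simp [innerQ, lineMul, mulAffine]
    ring
  rw [Orthogonal, h1, hxy]
  simp [lineMul, mulAffine, alpha, beta, gamma]
  ring

/-- As the form of `Q` is nondegenerate, the lines orthogonal to a given line are parallel. -/
theorem Orthogonal.parallel {Q : Quadrilateral k} {l a b : Line k} (ha : Q.Orthogonal l a)
    (hb : Q.Orthogonal l b) : a.Parallel b := by
  by_contra h
  have hd := lineDet_ne_zero h
  unfold Orthogonal innerQ at ha hb
  have e1 : Q.gamma * l.u - Q.beta * l.t = 0 := by
    refine (mul_eq_zero.1 ?_).resolve_left hd
    unfold lineDet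
    linear_combination a.t * hb - b.t * ha
  have e2 : Q.alpha * l.t - Q.beta * l.u = 0 := by
    refine (mul_eq_zero.1 ?_).resolve_left hd
    unfold lineDet
    linear_combination b.u * ha - a.u * hb
  have hu : l.u = 0 := by
    refine (mul_eq_zero.1 ?_).resolve_left Q.form_det_ne_zero
    linear_combination Q.alpha * e1 + Q.beta * e2
  have ht : l.t = 0 := by
    refine (mul_eq_zero.1 ?_).resolve_left Q.form_det_ne_zero
    linear_combination Q.beta * e1 + Q.gamma * e2
  rcases l.canonical with h | ⟨-, h⟩ <;> simp_all

theorem mid_left_cancel (h2 : (2 : k) ≠ 0) {p q q' : k × k} (h : mid p q = mid p q') :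
    q = q' := by
  simp only [mid, Prod.mk.injEq, div_left_inj' h2, add_right_inj] at h
  exact Prod.ext h.1 h.2

theorem isQPair_iff (h2 : (2 : k) ≠ 0) (Q : Quadrilateral k) {l l' : Line k} :
    Q.IsQPair l l' ↔ Q.InPencil (lineMul l l') := by
  constructor
  · rintro ⟨⟨p, p', hp, hp', hm⟩, ho⟩
    obtain ⟨_, h, hp⟩ := (Q.mem_bisectors_iff h2).1 hp
    obtain rfl := Option.some.inj h
    obtain ⟨_, h', hp'⟩ := (Q.mem_bisectors_iff h2).1 hp'
    obtain rfl := Option.some.inj h'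
    obtain ⟨l₁, h₁⟩ := hp.exists_partner
    obtain ⟨p₁, hp₁⟩ := InPencil.exists_isBisectorAt h2 (lineMul_comm l l₁ ▸ h₁)
    obtain rfl := mid_left_cancel h2 (hm.trans (h₁.mid_eq_centroid h2 hp hp₁).symm)
    rwa [(ho.parallel h₁.orthogonal).eq_of_contains hp'.1 hp₁.1]
  · intro h
    obtain ⟨p, hp⟩ := h.exists_isBisectorAt h2
    obtain ⟨p', hp'⟩ := InPencil.exists_isBisectorAt h2 (lineMul_comm l l' ▸ h)
    exact ⟨⟨p, p', (Q.mem_bisectors_iff h2).2 ⟨p, rfl, hp⟩,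
      (Q.mem_bisectors_iff h2).2 ⟨p', rfl, hp'⟩, h.mid_eq_centroid h2 hp hp'⟩, h.orthogonal⟩

theorem mem_bisectorField_iff (h2 : (2 : k) ≠ 0) (Q : Quadrilateral k) {a b : Line k} :
    s(a, b) ∈ Q.bisectorField ↔ Q.InPencil (lineMul a b) := by
  constructor
  · rintro ⟨l, l', h, hl⟩
    rw [lineMul_congr h]
    exact (Q.isQPair_iff h2).1 hl
  · intro h
    exact ⟨a, b, rfl, (Q.isQPair_iff h2).2 h⟩

/-! ### Quadratic functions that are critical at the midpoints of the sides -/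

/-- If a point of the line `c` is critical on `c` both for `a b` and for `b d`, then `a` and `d` meet
`c` in the same point. -/
theorem contains_of_dirDeriv_eq_zero {a b c d : Line k} {p o : k × k} (hb : ¬ b.Parallel c)
    (hd : ¬ d.Parallel c) (hp : c.Contains p) (ho : c.Contains o) (hdo : d.Contains o)
    (h : dirDeriv (lineMul a b) (lineDir c) p = 0)
    (h' : dirDeriv (lineMul b d) (lineDir c) p = 0) : a.Contains o := by
  obtain ⟨s, rfl⟩ := ho.exists_add_smul hp
  rw [dirDeriv_lineMul, lineEval_add_smul, lineEval_add_smul] at h h'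
  rw [lineEval_eq_zero.2 hdo] at h'
  have h1 : lineEval b o + 2 * (s * lineDet b c) = 0 := by
    refine (mul_eq_zero.1 ?_).resolve_left (lineDet_ne_zero hd)
    linear_combination h'
  rw [← lineEval_eq_zero]
  refine (mul_eq_zero.1 ?_).resolve_left (lineDet_ne_zero hb)
  linear_combination h - lineDet a c * h1

/-- The pencil of `Q` consists of all quadratic functions that are critical on each bisector at its
midpoint. Subtracting members of the pencil, one may assume that the function is constant on `A` and
on `B`, so that it is a multiple of `A B`; unless it vanishes, its critical points on `A'` and `B'`
force the four sides to be concurrent. -/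
theorem inPencil_of_dirDeriv_eq_zero (h2 : (2 : k) ≠ 0) (Q : Quadrilateral k) {q : QuadFun k}
    (h : ∀ l p, Q.IsBisectorAt l p → dirDeriv q (lineDir l) p = 0) : Q.InPencil q := by
  obtain ⟨pA, hA⟩ := Q.inPencil_AA'.exists_isBisectorAt h2
  obtain ⟨pB, hB⟩ := Q.inPencil_BB'.exists_isBisectorAt h2
  obtain ⟨pA', hA'⟩ := InPencil.exists_isBisectorAt h2 (lineMul_comm Q.A Q.A' ▸ Q.inPencil_AA')
  obtain ⟨pB', hB'⟩ := InPencil.exists_isBisectorAt h2 (lineMul_comm Q.B Q.B' ▸ Q.inPencil_BB')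
  have hlA : lead (lineMul Q.B Q.B') (lineDir Q.A) ≠ 0 :=
    (Q.lead_ne_zero Q.A).resolve_left (by simp [lead_lineMul, lineDet_self])
  have hlB : lead (lineMul Q.A Q.A') (lineDir Q.B) ≠ 0 :=
    (Q.lead_ne_zero Q.B).resolve_right (by simp [lead_lineMul, lineDet_self])
  set x := lead q (lineDir Q.B) / lead (lineMul Q.A Q.A') (lineDir Q.B) with hx
  set y := lead q (lineDir Q.A) / lead (lineMul Q.B Q.B') (lineDir Q.A) with hy
  obtain ⟨r, hr⟩ : ∃ r, q = r + (x • lineMul Q.A Q.A' + y • lineMul Q.B Q.B') :=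
    ⟨_, (sub_add_cancel _ _).symm⟩
  have hrq : r = (1 : k) • q + (-1 : k) • (x • lineMul Q.A Q.A' + y • lineMul Q.B Q.B') := by
    rw [hr]; module
  have hrs : ∀ l p, Q.IsBisectorAt l p → dirDeriv r (lineDir l) p = 0 := by
    intro l p hl
    rw [hrq, dirDeriv_comb, dirDeriv_comb, h l p hl, hl.2.1, hl.2.2]
    ring
  have hrA : lead r (lineDir Q.A) = 0 := by
    rw [hrq, lead_comb, lead_comb, lead_lineMul Q.A, lineDet_self, hy]
    field_simp
    ring
  have hrB : lead r (lineDir Q.B) = 0 := by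
    rw [hrq, lead_comb, lead_comb, lead_lineMul Q.B, lineDet_self, hx]
    field_simp
    ring
  suffices h0 : r = 0 by exact ⟨x, y, by rw [hr, h0, zero_add]⟩
  obtain ⟨m, rfl⟩ := exists_eq_mulAffine hA.1 hrA (hrs _ _ hA)
  have hAB := lineDet_ne_zero Q.not_parallel_AB
  rw [lead_mulAffine] at hrB
  have hm := (mul_eq_zero.1 hrB).resolve_left hAB
  have hm' := hrs _ _ hB
  rw [dirDeriv_mulAffine, hm, zero_mul, add_zero] at hm'
  obtain ⟨c, rfl⟩ := affine_eq_of_vanish hB.1 hm ((mul_eq_zero.1 hm').resolve_left hAB)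
  rw [mulAffine_eq_smul] at hrs ⊢
  have hsm : ∀ l p, dirDeriv (c • lineMul Q.A Q.B) (lineDir l) p =
      c * dirDeriv (lineMul Q.A Q.B) (lineDir l) p := by
    intro l p
    simpa using dirDeriv_comb c 0 (lineMul Q.A Q.B) 0 (lineDir l) p
  by_contra hc
  have hc : c ≠ 0 := by
    rintro rfl
    simp at hc
  have e1 := hrs _ _ hA'
  have e2 := hrs _ _ hB'
  rw [hsm] at e1 e2
  replace e1 := (mul_eq_zero.1 e1).resolve_left hc
  replace e2 := (mul_eq_zero.1 e2).resolve_left hc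
  rw [lineMul_comm] at e2
  have ho := (contains_iff_eq_meet Q.not_parallel_A'B' _).2 rfl
  exact Q.not_concurrent ⟨_,
    contains_of_dirDeriv_eq_zero Q.not_parallel_BA' (fun h => Q.not_parallel_A'B' h.symm)
      hA'.1 ho.1 ho.2 e1 hA'.2.2,
    contains_of_dirDeriv_eq_zero (fun h => Q.not_parallel_B'A h.symm) Q.not_parallel_A'B'
      hB'.1 ho.2 ho.1 e2 hB'.2.1, ho.1, ho.2⟩

/-! ### The bisector field of a quadrilateral -/

theorem mem_linesOf_bisectorField_iff (h2 : (2 : k) ≠ 0) (Q : Quadrilateral k) {l : Line k} :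
    l ∈ linesOf Q.bisectorField ↔ ∃ p, Q.IsBisectorAt l p := by
  constructor
  · rintro ⟨P, hP, hl⟩
    obtain ⟨l', rfl⟩ := hl
    exact ((Q.mem_bisectorField_iff h2).1 hP).exists_isBisectorAt h2
  · rintro ⟨p, hp⟩
    obtain ⟨l', hl'⟩ := hp.exists_partner
    exact ⟨s(l, l'), (Q.mem_bisectorField_iff h2).2 hl', Sym2.mem_mk_left _ _⟩

theorem isPairing_bisectorField (h2 : (2 : k) ≠ 0) (Q : Quadrilateral k) :
    Q.IsPairing Q.bisectorField := by
  constructor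
  · ext l
    rw [mem_linesOf_bisectorField_iff h2]
    constructor
    · rintro ⟨p, hp⟩
      exact ⟨(l, some p), (Q.mem_bisectors_iff h2).2 ⟨p, rfl, hp⟩, rfl⟩
    · rintro ⟨⟨_, m⟩, hm, rfl⟩
      obtain ⟨p, -, hp⟩ := (Q.mem_bisectors_iff h2).1 hm
      exact ⟨p, hp⟩
  · intro l m hm a b hab hc
    obtain ⟨p, rfl, hp⟩ := (Q.mem_bisectors_iff h2).1 hm
    exact hp.crossMid_eq h2 ((Q.mem_bisectorField_iff h2).1 hab) hc

theorem IsPairing.union {Q : Quadrilateral k} {S T : Set (Sym2 (Line k))} (hS : Q.IsPairing S)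
    (hT : Q.IsPairing T) : Q.IsPairing (S ∪ T) := by
  constructor
  · have h : linesOf (S ∪ T) = linesOf S ∪ linesOf T := by
      ext l
      simp only [linesOf, Set.mem_union, Set.mem_ofPred_eq, or_and_right, exists_or]
    rw [h, hS.1, hT.1, Set.union_self]
  · rintro l m hm a b (hab | hab) hc
    · exact hS.2 l m hm a b hab hc
    · exact hT.2 l m hm a b hab hc

theorem IsPairing.isBisectorArrangement {Q : Quadrilateral k} {S : Set (Sym2 (Line k))}
    (hS : Q.IsPairing S) : IsBisectorArrangement S := by
  intro l hl a b a' b' h h' hc hc'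
  rw [hS.1] at hl
  obtain ⟨⟨_, m⟩, hm, rfl⟩ := hl
  rw [hS.2 _ m hm a b h hc, hS.2 _ m hm a' b' h' hc']

theorem oppositeSides_subset_bisectorField (h2 : (2 : k) ≠ 0) (Q : Quadrilateral k) :
    Q.oppositeSides ⊆ Q.bisectorField := by
  intro P
  induction P with
  | _ a b => exact fun h => (Q.mem_bisectorField_iff h2).2 (inPencil_of_mem_oppositeSides h)

/-- A bisector arrangement that contains the bisector field of `Q` is equal to it. -/
theorem eq_bisectorField_of_subset (h2 : (2 : k) ≠ 0) (Q : Quadrilateral k)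
    {T : Set (Sym2 (Line k))} (hT : IsBisectorArrangement T) (h : Q.bisectorField ⊆ T) :
    T = Q.bisectorField := by
  refine Set.Subset.antisymm (fun P => ?_) h
  induction P with
  | _ a b =>
    intro hab
    refine (Q.mem_bisectorField_iff h2).2 (Q.inPencil_of_dirDeriv_eq_zero h2 fun l p hp => ?_)
    obtain ⟨P, hP, hl⟩ := (Q.mem_linesOf_bisectorField_iff h2).2 ⟨p, hp⟩
    obtain ⟨p', hp', hcrit⟩ := Q.exists_of_bisects h2
      ((Q.oppositeSides_subset_bisectorField h2).trans h) (hT l ⟨P, h hP, hl⟩)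
    rw [hp.unique h2 hp']
    exact hcrit a b hab

theorem not_isTrivialArrangement_bisectorField (h2 : (2 : k) ≠ 0) (Q : Quadrilateral k) :
    ¬ IsTrivialArrangement Q.bisectorField := by
  have h1 : s(Q.A, Q.A') ∈ Q.bisectorField := Q.oppositeSides_subset_bisectorField h2 (Or.inl rfl)
  have h3 : s(Q.B, Q.B') ∈ Q.bisectorField := Q.oppositeSides_subset_bisectorField h2 (Or.inr rfl)
  have hA : Q.A ∈ linesOf Q.bisectorField := ⟨_, h1, Sym2.mem_mk_left _ _⟩
  have hA' : Q.A' ∈ linesOf Q.bisectorField := ⟨_, h1, Sym2.mem_mk_right _ _⟩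
  have hB : Q.B ∈ linesOf Q.bisectorField := ⟨_, h3, Sym2.mem_mk_left _ _⟩
  have hB' : Q.B' ∈ linesOf Q.bisectorField := ⟨_, h3, Sym2.mem_mk_right _ _⟩
  rintro (⟨p, hp⟩ | h | h)
  · exact Q.not_concurrent ⟨p, hp _ hA, hp _ hB, hp _ hA', hp _ hB'⟩
  · exact Q.not_parallel_AB (h _ hA _ hB)
  · obtain ⟨w, hw⟩ := h _ h1 _ h3
    rw [Sym2.map_mk, Sym2.eq_iff] at hw
    rcases hw with ⟨hw, -⟩ | ⟨hw, -⟩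
    · exact Q.not_parallel_AB (by rw [hw]; exact ⟨rfl, rfl⟩)
    · exact Q.not_parallel_BA' (by rw [hw]; exact ⟨rfl, rfl⟩)

theorem isBisectorField_bisectorField (h2 : (2 : k) ≠ 0) (Q : Quadrilateral k) :
    IsBisectorField Q.bisectorField :=
  ⟨(Q.isPairing_bisectorField h2).isBisectorArrangement,
    Q.not_isTrivialArrangement_bisectorField h2,
    fun _ hT h => Q.eq_bisectorField_of_subset h2 hT h⟩

/-- The union of two pairings of the bisectors of `Q` is a bisector arrangement, so that two
maximal ones coincide. -/
theorem isPairing_and_isBisectorField_iff (h2 : (2 : k) ≠ 0) (Q : Quadrilateral k)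
    (S : Set (Sym2 (Line k))) :
    (Q.IsPairing S ∧ IsBisectorField S) ↔ S = Q.bisectorField := by
  constructor
  · rintro ⟨hP, hS⟩
    have hU := (hP.union (Q.isPairing_bisectorField h2)).isBisectorArrangement
    rw [← hS.2.2 _ hU Set.subset_union_left]
    exact Q.eq_bisectorField_of_subset h2 hU Set.subset_union_right
  · rintro rfl
    exact ⟨Q.isPairing_bisectorField h2, Q.isBisectorField_bisectorField h2⟩

theorem bisectors_subset_of_bisectorField_eq (h2 : (2 : k) ≠ 0) {Q₁ Q₂ : Quadrilateral k}
    (h : Q₁.bisectorField = Q₂.bisectorField) : Q₁.bisectors ⊆ Q₂.bisectors := by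
  rintro ⟨l, m⟩ ⟨hl, a, b, hab, hc, hm⟩
  have hP := Q₂.isPairing_bisectorField h2
  have h0 : l ∈ linesOf Q₁.bisectorField := by
    rw [(Q₁.isPairing_bisectorField h2).1]
    exact ⟨(l, m), ⟨hl, a, b, hab, hc, hm⟩, rfl⟩
  rw [h, hP.1] at h0
  obtain ⟨⟨_, m'⟩, hm', rfl⟩ := h0
  have e : m = m' := hm.symm.trans (hP.2 _ _ hm' a b (h ▸ Q₁.oppositeSides_subset_bisectorField h2 hab) hc)
  rw [e]
  exact hm'

end Quadrilateral

theorem corollary6p10 {k : Type*} [Field k] (hk : ringChar k ≠ 2) :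
    (∀ Q₁ Q₂ : Quadrilateral k,
      Q₁.bisectors = Q₂.bisectors ↔ Q₁.bisectorField = Q₂.bisectorField) ∧
    (∀ (Q : Quadrilateral k) (S : Set (Sym2 (Line k))),
      (Q.IsPairing S ∧ IsBisectorField S) ↔ S = Q.bisectorField) := by
  have h2 : (2 : k) ≠ 0 := Ring.two_ne_zero hk
  refine ⟨fun Q₁ Q₂ => ⟨fun h => ?_, fun h => ?_⟩,
    fun Q S => Q.isPairing_and_isBisectorField_iff h2 S⟩
  · have h1 := (Q₁.isPairing_and_isBisectorField_iff h2 _).2 rfl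
    refine (Q₂.isPairing_and_isBisectorField_iff h2 _).1 ⟨?_, h1.2⟩
    unfold Quadrilateral.IsPairing at h1 ⊢
    rw [← h]
    exact h1.1
  · exact Set.Subset.antisymm (Quadrilateral.bisectors_subset_of_bisectorField_eq h2 h)
      (Quadrilateral.bisectors_subset_of_bisectorField_eq h2 h.symm)
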